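/- Let $n\ge 0$ and $0\le k\le 2n$ be integers. Let $a_j$ ($1\le j\le n$) be the annihilation operators of an $n$ mode fermionic system on its $2^n$-dimensional Fock space, and let $\gamma_{2j-1}=a_j^\dagger+a_j$, $\gamma_{2j}=i(a_j^\dagger-a_j)$ be the $2n$ Majorana operators. Let $\mathcal S_k$ be the set of $k$-element subsets of $\{1,\dots,2n\}$, and for $S=\{j_1<\dots<j_k\}\in\mathcal S_k$ let $\gamma_S=i^{\binom k2}\gamma_{j_1}\cdots\gamma_{j_k}$ (with $\gamma_\varnothing=1$). For real $\eta$ put $\mathsf M_S^\eta(\pm1)=\tfrac12(1\pm\eta\gamma_S)$. The family $(\mathsf M^\eta_S)_{S\in\mathcal S_k}$ is called compatible if every $\mathsf M_S^\eta$ is a POVM and there are a POVM $\mathsf G$ with a finite outcome set $\Lambda$ and numbers $D(e|S,\lambda)\in[0,1]$ with $\sum_{e=\pm1}D(e|S,\lambda)=1$ such that $\mathsf M^\eta_S(e)=\sum_{\lambda\in\Lambda}D(e|S,\lambda)\,\mathsf G(\lambda)$ for all $S\in\mathcal S_k$ and $e\in\{\pm1\}$. Then the incompatibility robustness $$\eta_k^*=\sup\{\eta\in\mathbb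 R \mid (\mathsf M^\eta_S)_{S\in\mathcal S_k}\text{ is compatible}\}$$ is attained (the supremum is a maximum), and $$\eta_k^*=\frac1{|\mathcal S_k|}\max_{e_S\in\{\pm1\}\ \forall S\in\mathcal S_k}\Big\|\sum_{S\in\mathcal S_k}e_S\gamma_S\Big\|_\infty ,$$ where $\|\cdot\|_\infty$ is the operator norm. -/

import Mathlib

open scoped ComplexOrder Matrix Matrix.Norms.L2Operator

noncomputable section

namespace MajoranaJM

/-! ### Measurements and joint measurability -/

/-- A POVM on `ℂ^d` with finite outcome set `Ω`: positive semidefinite effects summing to the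
identity. -/
def IsPOVM {d Ω : Type} [Fintype d] [DecidableEq d] [Fintype Ω]
    (M : Ω → Matrix d d ℂ) : Prop :=
  (∀ e, (M e).PosSemidef) ∧ ∑ e, M e = 1

/-- The measurements `M j`, `j ∈ J`, with outcome sets `Ω j`, are jointly measurable: each is a POVM
and there is a single parent POVM `G` with finite outcome set `Λ`, together with a classical
post-processing `D j l e = D(e | j, l)`, such that `M j e = ∑ l, D(e | j, l) G l`. -/
def JointlyMeasurable {d J : Type} {Ω : J → Type} [Fintype d] [DecidableEq d]
    [∀ j, Fintype (Ω j)] (M : (j : J) → Ω j → Matrix d d ℂ) : Prop :=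
  (∀ j, IsPOVM (M j)) ∧
  ∃ (Λ : Type) (_ : Fintype Λ) (G : Λ → Matrix d d ℂ) (D : (j : J) → Λ → Ω j → ℝ),
    IsPOVM G ∧
    (∀ j l e, 0 ≤ D j l e ∧ D j l e ≤ 1) ∧
    (∀ j l, ∑ e, D j l e = 1) ∧
    ∀ j e, M j e = ∑ l, (D j l e : ℂ) • G l

/-! ### The `n` mode fermionic system -/

/-- Operators on the Fock space of `n` fermionic modes, as matrices in the occupation number basis;
a basis vector is labelled by the set of occupied modes. The dimension is `2 ^ n`. -/
abbrev FockOp (n : ℕ) : Type := Matrix (Finset (Fin n)) (Finset (Fin n)) ℂ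

/-- The annihilation operator `a_j`: it sends the basis vector with occupied set `T` to
`(-1)^{#{l ∈ T : l < j}}` times the one with occupied set `T \ {j}` if `j ∈ T`, and to `0` if
`j ∉ T`. -/
def annihilation {n : ℕ} (j : Fin n) : FockOp n :=
  Matrix.of fun T' T =>
    if j ∈ T ∧ T' = T.erase j then (-1 : ℂ) ^ (T.filter (fun l => l < j)).card else 0

/-- The creation operator `a_j†`, the adjoint of `a_j`. -/
def creation {n : ℕ} (j : Fin n) : FockOp n := (annihilation j)ᴴ

/-- The `2n` Majorana operators. With modes and operators both numbered from `0`, operator `2j` is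
`a_j† + a_j` and operator `2j + 1` is `i (a_j† - a_j)`. -/
def majorana {n : ℕ} (m : Fin (2 * n)) : FockOp n :=
  let j : Fin n := ⟨m.val / 2, Nat.div_lt_of_lt_mul m.isLt⟩
  if m.val % 2 = 0 then creation j + annihilation j
  else Complex.I • (creation j - annihilation j)

/-- The index set `𝒮_k` of all `k`-element subsets of the `2n` Majorana labels. -/
abbrev IndexSet (n k : ℕ) : Type := {S : Finset (Fin (2 * n)) // S.card = k}

/-- The Majorana observable `γ_S = i^{binom(|S|, 2)} γ_{j_1} ⋯ γ_{j_k}` with `j_1 < ⋯ < j_k` the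
elements of `S` in ascending order. -/
def majoranaObs {n : ℕ} (S : Finset (Fin (2 * n))) : FockOp n :=
  Complex.I ^ (S.card.choose 2) • ((S.sort (· ≤ ·)).map majorana).prod

/-- The unsharp measurement `M_S(±) = (1 ± η γ_S) / 2`; the outcomes `±1` are the units of `ℤ`. -/
def unsharp {n : ℕ} (η : ℝ) (S : Finset (Fin (2 * n))) (e : ℤˣ) : FockOp n :=
  (1 / 2 : ℂ) • (1 + (((e : ℤ) : ℂ) * (η : ℂ)) • majoranaObs S)

/-- The sharpnesses `η` for which all the degree-`k` unsharp Majorana measurements are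
jointly measurable. -/
def compatibleSharpness (n k : ℕ) : Set ℝ :=
  {η : ℝ | JointlyMeasurable (fun (S : IndexSet n k) (e : ℤˣ) => unsharp η S.1 e)}

/-- The incompatibility robustness `η_k^*` of the degree-`k` Majorana observables. -/
def incompatibilityRobustness (n k : ℕ) : ℝ := sSup (compatibleSharpness n k)

/-- The operator `H_k = ∑_S e_S γ_S` for a choice of signs `e_S ∈ {±1}`. -/
def signedSum {n k : ℕ} (e : IndexSet n k → ℤˣ) : FockOp n :=
  ∑ S : IndexSet n k, ((e S : ℤ) : ℂ) • majoranaObs S.1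

/-- The maximum over all sign choices of the operator norm of `H_k`. -/
def maxNorm (n k : ℕ) : ℝ :=
  (Finset.univ : Finset (IndexSet n k → ℤˣ)).sup' Finset.univ_nonempty fun e => ‖signedSum e‖

end MajoranaJM

end

noncomputable section

namespace MajoranaJM

/-! Compatibility at sharpness η means that positive `G l` with sum 1 and weights `f S l` in [-1, 1]
satisfy `η γ_S = ∑ l, f S l • G l` (`jointlyMeasurable_iff_simulates`).

Upper bound: multiply by `γ_S` and take traces, so that `η 2^n = ∑ l, f S l tr(γ_S G l)`. Summed
over S, the right side is at most `∑ l, ∑ S, |tr(γ_S G l)|`. For each l the inner sum is `tr(H G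
l)`, with `H` a signed sum adapted to l, and so is at most `maxNorm * tr(G l)`; the traces add up to
`2^n`.

Attainment: let `P` project onto an eigenvector of an optimal `H = ∑ e_S γ_S` with eigenvalue ±‖H‖.
The single operator `P` simulates the family `e_S P`. Twirling over the Majorana operators turns `P`
into a multiple of 1 and `e_S P` into the same multiple of `e_S tr(γ_S P) γ_S`
(`Simulates.of_trace_eq_one`). Averaging over permutations of the labels, implemented by unitaries
up to signs, replaces these coefficients by their mean, `tr(H P)` divided by the number of subsets
(`Simulates.average`). Signs never matter, since they can be absorbed into the weights
(`Simulates.of_eq_or_neg`). -/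

/-! ### Majorana operators as signed shifts -/

/-- The Jordan–Wigner sign of mode `j` on the occupied set `T`. -/
def jwSign {n : ℕ} (j : Fin n) (T : Finset (Fin n)) : ℂ :=
  (-1 : ℂ) ^ (T.filter (fun l => l < j)).card

lemma jwSign_mul_self {n : ℕ} (j : Fin n) (T : Finset (Fin n)) :
    jwSign j T * jwSign j T = 1 := by
  rw [jwSign, ← mul_pow]; norm_num

lemma star_jwSign {n : ℕ} (j : Fin n) (T : Finset (Fin n)) :
    star (jwSign j T) = jwSign j T := by
  simp [jwSign]

lemma jwSign_insert {n : ℕ} (j l : Fin n) (T : Finset (Fin n)) (h : l ∉ T) :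
    jwSign j (insert l T) = jwSign j T * (if l < j then -1 else 1) := by
  unfold jwSign
  rw [Finset.filter_insert]
  split_ifs with h1
  · rw [Finset.card_insert_of_notMem (by simp [h]), pow_succ]
  · simp

lemma jwSign_symmDiff {n : ℕ} (j l : Fin n) (T : Finset (Fin n)) :
    jwSign j (symmDiff T {l}) = jwSign j T * (if l < j then -1 else 1) := by
  by_cases h : l ∈ T
  · have h1 : symmDiff T {l} = T.erase l := by
      ext x; simp only [Finset.mem_symmDiff, Finset.mem_singleton, Finset.mem_erase]; grind
    have h2 := jwSign_insert j l (T.erase l) (by simp)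
    rw [Finset.insert_erase h] at h2
    rw [h1, h2]
    split_ifs <;> ring
  · have h1 : symmDiff T {l} = insert l T := by
      ext x; simp only [Finset.mem_symmDiff, Finset.mem_singleton, Finset.mem_insert]; grind
    rw [h1, jwSign_insert j l T h]

lemma symmDiff_singleton_eq_iff {n : ℕ} (j : Fin n) (T T' : Finset (Fin n)) :
    T' = symmDiff T {j} ↔ T = symmDiff T' {j} := by
  constructor <;> rintro rfl <;> simp

/-- The operator sending the basis vector `T` to `φ T` times the basis vector `T ∆ {j}`. -/
def weightedShift {n : ℕ} (j : Fin n) (φ : Finset (Fin n) → ℂ) : FockOp n :=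
  Matrix.of fun T' T => if T' = symmDiff T {j} then φ T else 0

lemma weightedShift_mul {n : ℕ} (j l : Fin n) (φ ψ : Finset (Fin n) → ℂ) :
    weightedShift j φ * weightedShift l ψ =
      Matrix.of fun T' T => if T' = symmDiff (symmDiff T {l}) {j}
        then φ (symmDiff T {l}) * ψ T else 0 := by
  ext T' T
  simp [weightedShift, Matrix.mul_apply]

/-- The mode to which a Majorana operator belongs. -/
def modeOf {n : ℕ} (m : Fin (2 * n)) : Fin n := ⟨m.val / 2, Nat.div_lt_of_lt_mul m.isLt⟩

/-- The phase which the Majorana operator `m` gives to the basis vector `T`. -/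
def majoranaPhase {n : ℕ} (m : Fin (2 * n)) (T : Finset (Fin n)) : ℂ :=
  jwSign (modeOf m) T *
    (if m.val % 2 = 0 then 1 else if modeOf m ∈ T then -Complex.I else Complex.I)

lemma annihilation_eq {n : ℕ} (j : Fin n) :
    annihilation j = weightedShift j (fun T => if j ∈ T then jwSign j T else 0) := by
  ext T' T
  simp only [annihilation, weightedShift, Matrix.of_apply, jwSign]
  by_cases h : j ∈ T
  · have h1 : symmDiff T {j} = T.erase j := by
      ext x; simp only [Finset.mem_symmDiff, Finset.mem_singleton, Finset.mem_erase]; grind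
    simp [h, h1]
  · simp [h]

lemma creation_eq {n : ℕ} (j : Fin n) :
    creation j = weightedShift j (fun T => if j ∈ T then 0 else jwSign j T) := by
  ext T' T
  rw [creation, annihilation_eq, Matrix.conjTranspose_apply]
  simp only [weightedShift, Matrix.of_apply]
  by_cases hT : T = symmDiff T' {j}
  · rw [if_pos hT, if_pos ((symmDiff_singleton_eq_iff j T T').mpr hT)]
    subst hT
    by_cases h : j ∈ T' <;>
      simp [h, Finset.mem_symmDiff, star_jwSign, jwSign_symmDiff, -RCLike.star_def]
  · rw [if_neg hT, if_neg fun h => hT ((symmDiff_singleton_eq_iff j T T').mp h), star_zero]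

/-- Both parities become one kind of operator, a shift with a phase, so the Clifford relations
reduce to comparing phases. -/
lemma majorana_eq {n : ℕ} (m : Fin (2 * n)) :
    majorana m = weightedShift (modeOf m) (majoranaPhase m) := by
  ext T' T
  change (if m.val % 2 = 0 then creation (modeOf m) + annihilation (modeOf m)
    else Complex.I • (creation (modeOf m) - annihilation (modeOf m))) T' T = _
  rw [creation_eq, annihilation_eq]
  by_cases h : m.val % 2 = 0 <;> by_cases hT : T' = symmDiff T {modeOf m} <;>
    by_cases hm : modeOf m ∈ T <;>
    simp [weightedShift, majoranaPhase, h, hT, hm, mul_comm]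

lemma majorana_mul {n : ℕ} (m m' : Fin (2 * n)) :
    majorana m * majorana m' =
      Matrix.of fun T' T => if T' = symmDiff (symmDiff T {modeOf m'}) {modeOf m}
        then majoranaPhase m (symmDiff T {modeOf m'}) * majoranaPhase m' T else 0 := by
  rw [majorana_eq, majorana_eq, weightedShift_mul]

lemma majorana_mul_self {n : ℕ} (m : Fin (2 * n)) : majorana m * majorana m = 1 := by
  rw [majorana_mul]
  ext T' T
  rw [Matrix.of_apply, symmDiff_assoc, symmDiff_self, symmDiff_bot,
    Matrix.one_apply]
  refine if_congr Iff.rfl ?_ rfl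
  have h := jwSign_mul_self (modeOf m) T
  simp only [majoranaPhase, jwSign_symmDiff, lt_irrefl, if_false, mul_one]
  split_ifs with h1 h2 h3 h3
  · linear_combination h
  · simp [Finset.mem_symmDiff, h3] at h2
  · linear_combination h - jwSign (modeOf m) T ^ 2 * Complex.I_sq
  · linear_combination h - jwSign (modeOf m) T ^ 2 * Complex.I_sq
  · simp [Finset.mem_symmDiff, h3] at h2

lemma majorana_anticomm {n : ℕ} {m m' : Fin (2 * n)} (hne : m ≠ m') :
    majorana m * majorana m' = -(majorana m' * majorana m) := by
  rw [majorana_mul, majorana_mul]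
  ext T' T
  rw [Matrix.neg_apply, Matrix.of_apply, Matrix.of_apply, symmDiff_right_comm]
  by_cases hT : T' = symmDiff (symmDiff T {modeOf m}) {modeOf m'}
  swap
  · simp [hT]
  simp only [if_pos hT, majoranaPhase, jwSign_symmDiff]
  by_cases hj : modeOf m = modeOf m'
  · have hv : m.val / 2 = m'.val / 2 := congrArg Fin.val hj
    have hne' : m.val ≠ m'.val := fun h => hne (Fin.ext h)
    rw [hj]
    simp only [lt_irrefl, if_false, mul_one]
    by_cases h1 : m.val % 2 = 0
    · have h2 : m'.val % 2 ≠ 0 := by omega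
      by_cases h3 : modeOf m' ∈ T <;> simp [h1, h2, h3, Finset.mem_symmDiff] <;> ring
    · have h2 : m'.val % 2 = 0 := by omega
      by_cases h3 : modeOf m' ∈ T <;> simp [h1, h2, h3, Finset.mem_symmDiff] <;> ring
  · have e1 : modeOf m ∈ symmDiff T {modeOf m'} ↔ modeOf m ∈ T := by
      simp [Finset.mem_symmDiff, hj]
    have e2 : modeOf m' ∈ symmDiff T {modeOf m} ↔ modeOf m' ∈ T := by
      simp [Finset.mem_symmDiff, Ne.symm hj]
    simp only [e1, e2]
    -- For distinct modes exactly one of the two Jordan–Wigner signs sees the other mode flipped.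
    rcases lt_or_gt_of_ne hj with hl | hl
    · rw [if_neg hl.not_gt, if_pos hl]; ring
    · rw [if_neg hl.not_gt, if_pos hl]; ring

lemma majorana_conjTranspose {n : ℕ} (m : Fin (2 * n)) : (majorana m)ᴴ = majorana m := by
  unfold majorana creation
  simp only
  split_ifs
  · simp [add_comm]
  · simp only [Matrix.conjTranspose_smul, Matrix.conjTranspose_sub,
      Matrix.conjTranspose_conjTranspose]
    rw [← neg_sub (annihilation _)ᴴ, smul_neg]
    simp

/-! ### Irreducibility -/

lemma commute_annihilation {n : ℕ} {B : FockOp n} (h : ∀ m : Fin (2 * n), Commute B (majorana m))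
    (j : Fin n) : Commute B (annihilation j) ∧ Commute B (creation j) := by
  have h0 := h ⟨2 * j.val, by omega⟩
  have h1 := h ⟨2 * j.val + 1, by omega⟩
  have e0 : majorana (⟨2 * j.val, by omega⟩ : Fin (2 * n)) = creation j + annihilation j := by
    simp [majorana]
  have e1 : majorana (⟨2 * j.val + 1, by omega⟩ : Fin (2 * n)) =
      Complex.I • (creation j - annihilation j) := by
    have : (2 * j.val + 1) / 2 = j.val := by omega
    simp [majorana, this]
  rw [e0] at h0
  rw [e1] at h1
  have h2 : Commute B (creation j - annihilation j) := by
    have := h1.smul_right (-Complex.I)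
    simpa [smul_smul] using this
  constructor
  · have e : annihilation j = (1 / 2 : ℂ) •
        (creation j + annihilation j - (creation j - annihilation j)) := by module
    rw [e]
    exact (h0.sub_right h2).smul_right (1 / 2 : ℂ)
  · have e : creation j = (1 / 2 : ℂ) •
        (creation j + annihilation j + (creation j - annihilation j)) := by module
    rw [e]
    exact (h0.add_right h2).smul_right (1 / 2 : ℂ)

lemma creation_mul_annihilation {n : ℕ} (j : Fin n) :
    creation j * annihilation j = Matrix.diagonal fun T => if j ∈ T then (1 : ℂ) else 0 := by
  rw [creation_eq, annihilation_eq, weightedShift_mul]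
  ext T' T
  rw [Matrix.of_apply, symmDiff_assoc, symmDiff_self, symmDiff_bot, Matrix.diagonal_apply]
  by_cases hT : T' = T
  · subst hT
    by_cases h : j ∈ T' <;>
      simp [h, Finset.mem_symmDiff, jwSign_symmDiff, jwSign_mul_self]
  · simp [hT]

/-- Commuting with the number operators `a_j† a_j` kills the off-diagonal entries, as these
operators separate basis vectors; commuting with `a_j` then equates the diagonal entries at `T` and
`insert j T`. -/
lemma eq_smul_one_of_commute_majorana {n : ℕ} {B : FockOp n}
    (h : ∀ m : Fin (2 * n), Commute B (majorana m)) : ∃ c : ℂ, B = c • 1 := by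
  have hdiag : ∀ T T' : Finset (Fin n), T ≠ T' → B T T' = 0 := by
    intro T T' hne
    obtain ⟨j, hj⟩ : ∃ j, ¬ (j ∈ T ↔ j ∈ T') := by
      by_contra! hc
      exact hne (Finset.ext hc)
    have hc := ((commute_annihilation h j).2.mul_right (commute_annihilation h j).1).eq
    rw [creation_mul_annihilation] at hc
    have := congrFun (congrFun hc T) T'
    rw [Matrix.mul_diagonal, Matrix.diagonal_mul] at this
    by_cases h1 : j ∈ T <;> by_cases h2 : j ∈ T' <;> simp_all
  have hins : ∀ (T : Finset (Fin n)) (j : Fin n), j ∉ T → B (insert j T) (insert j T) = B T T := by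
    intro T j hj
    have hc := congrFun (congrFun (commute_annihilation h j).1.eq T) (insert j T)
    rw [Matrix.mul_apply, Matrix.mul_apply, Finset.sum_eq_single T, Finset.sum_eq_single (insert j T)]
      at hc
    · simp only [annihilation, Matrix.of_apply, Finset.mem_insert_self,
        Finset.erase_insert hj, true_and, if_true] at hc
      rw [mul_comm] at hc
      exact (mul_left_cancel₀ (pow_ne_zero _ (by norm_num)) hc).symm
    · intro T' _ hT'; rw [hdiag _ _ hT', mul_zero]
    · simp
    · intro T' _ hT'; rw [hdiag _ _ hT'.symm, zero_mul]
    · simp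
  refine ⟨B ∅ ∅, ?_⟩
  ext T T'
  rw [Matrix.smul_apply, Matrix.one_apply]
  split_ifs with hT
  · subst hT
    induction T using Finset.induction_on with
    | empty => simp
    | insert j T hj ih => rw [hins T j hj, ih]
  · rw [hdiag _ _ hT]; simp

/-! ### Products of Majorana operators -/

lemma prod_majorana_perm {n : ℕ} {l l' : List (Fin (2 * n))} (h : l.Perm l') (hl : l.Nodup) :
    (l.map majorana).prod = (l'.map majorana).prod ∨
      (l.map majorana).prod = -(l'.map majorana).prod := by
  induction h with
  | nil => simp
  | cons x _ ih =>
    rcases ih hl.of_cons with h | h <;> simp [h]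
  | swap x y l =>
    have hne : y ≠ x := by
      intro h; simp [h] at hl
    right
    simp only [List.map_cons, List.prod_cons]
    rw [← mul_assoc, majorana_anticomm hne, neg_mul, mul_assoc]
  | trans h1 h2 ih1 ih2 =>
    rcases ih1 hl with h | h <;> rcases ih2 (h1.nodup_iff.mp hl) with h' | h' <;> simp [h, h']

lemma prod_majorana_mul {n : ℕ} {a : Fin (2 * n)} {l : List (Fin (2 * n))} (ha : a ∉ l) :
    (l.map majorana).prod * majorana a =
      (-1 : ℂ) ^ l.length • (majorana a * (l.map majorana).prod) := by
  induction l with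
  | nil => simp
  | cons b l ih =>
    have hab : b ≠ a := fun h => ha (by simp [h])
    have ih' := ih fun h => ha (List.mem_cons_of_mem _ h)
    rw [List.map_cons, List.prod_cons, mul_assoc, ih', mul_smul_comm, ← mul_assoc,
      majorana_anticomm hab, List.length_cons, pow_succ, neg_mul, mul_assoc]
    module

lemma prod_majorana_reverse {n : ℕ} {l : List (Fin (2 * n))} (hl : l.Nodup) :
    (l.reverse.map majorana).prod =
      (-1 : ℂ) ^ (l.length.choose 2) • (l.map majorana).prod := by
  induction l with
  | nil => simp
  | cons a l ih =>
    rw [List.nodup_cons] at hl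
    rw [List.reverse_cons, List.map_append, List.prod_append, ih hl.2, List.map_singleton,
      List.prod_singleton, smul_mul_assoc, prod_majorana_mul hl.1, smul_smul, List.map_cons,
      List.prod_cons, List.length_cons, Nat.choose_succ_succ' l.length 1, Nat.choose_one_right,
      pow_add, mul_comm]

lemma prod_majorana_conjTranspose {n : ℕ} (l : List (Fin (2 * n))) :
    ((l.map majorana).prod)ᴴ = (l.reverse.map majorana).prod := by
  rw [Matrix.conjTranspose_list_prod, List.map_map, List.map_reverse]
  congr 3
  funext m
  exact majorana_conjTranspose m

lemma prod_majorana_mul_conjTranspose {n : ℕ} (l : List (Fin (2 * n))) :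
    (l.map majorana).prod * ((l.map majorana).prod)ᴴ = 1 := by
  induction l with
  | nil => simp
  | cons a l ih =>
    rw [List.map_cons, List.prod_cons, Matrix.conjTranspose_mul, mul_assoc,
      ← mul_assoc _ _ (majorana a)ᴴ, ih, one_mul, majorana_conjTranspose, majorana_mul_self]

/-- Reversing k anticommuting factors costs `(-1)^(k choose 2)`, which the phase `I ^ (k choose 2)`
compensates. -/
lemma majoranaObs_conjTranspose {n : ℕ} (S : Finset (Fin (2 * n))) :
    (majoranaObs S)ᴴ = majoranaObs S := by
  rw [majoranaObs, Matrix.conjTranspose_smul, prod_majorana_conjTranspose,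
    prod_majorana_reverse (Finset.sort_nodup _ _), Finset.length_sort, smul_smul]
  congr 1
  rw [star_pow, ← mul_pow]
  simp

lemma majoranaObs_mul_self {n : ℕ} (S : Finset (Fin (2 * n))) :
    majoranaObs S * majoranaObs S = 1 := by
  nth_rewrite 2 [← majoranaObs_conjTranspose]
  rw [majoranaObs, Matrix.conjTranspose_smul, smul_mul_smul_comm, prod_majorana_mul_conjTranspose,
    star_pow, ← mul_pow]
  simp

lemma conj_prod_majorana {n : ℕ} {U : FockOp n} (hU : U * U = 1) (σ : Equiv.Perm (Fin (2 * n)))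
    (h : ∀ m, U * majorana m * U = majorana (σ m) ∨ U * majorana m * U = -majorana (σ m))
    (l : List (Fin (2 * n))) :
    U * (l.map majorana).prod * U = ((l.map σ).map majorana).prod ∨
      U * (l.map majorana).prod * U = -((l.map σ).map majorana).prod := by
  induction l with
  | nil => simp [hU]
  | cons a l ih =>
    have e : U * (majorana a * (l.map majorana).prod) * U =
        (U * majorana a * U) * (U * (l.map majorana).prod * U) := by
      simp only [mul_assoc]
      rw [← mul_assoc U U, hU, one_mul]
    simp only [List.map_cons, List.prod_cons, e]
    rcases h a with h | h <;> rcases ih with h' | h' <;> simp [h, h']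

/-- The conjugated factors are permuted Majoranas in the wrong order; sorting them costs only a
sign. -/
lemma conj_majoranaObs {n : ℕ} {U : FockOp n} (hU : U * U = 1) (σ : Equiv.Perm (Fin (2 * n)))
    (h : ∀ m, U * majorana m * U = majorana (σ m) ∨ U * majorana m * U = -majorana (σ m))
    (S : Finset (Fin (2 * n))) :
    U * majoranaObs S * U = majoranaObs (S.map σ.toEmbedding) ∨
      U * majoranaObs S * U = -majoranaObs (S.map σ.toEmbedding) := by
  have hp : ((S.sort (· ≤ ·)).map σ).Perm ((S.map σ.toEmbedding).sort (· ≤ ·)) := by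
    rw [List.perm_ext_iff_of_nodup ((Finset.sort_nodup _ _).map σ.injective)
      (Finset.sort_nodup _ _)]
    intro a
    simp only [List.mem_map, Finset.mem_sort, Finset.mem_map, Equiv.coe_toEmbedding]
  have h1 := conj_prod_majorana hU σ h (S.sort (· ≤ ·))
  have h2 := prod_majorana_perm hp ((Finset.sort_nodup _ _).map σ.injective)
  simp only [majoranaObs, Finset.card_map, mul_smul_comm, smul_mul_assoc]
  rcases h1 with h1 | h1 <;> rcases h2 with h2 | h2 <;> simp only [h1, h2, neg_neg, smul_neg] <;>
    simp

lemma conj_majorana {n : ℕ} (j m : Fin (2 * n)) :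
    majorana j * majorana m * majorana j = majorana m ∨
      majorana j * majorana m * majorana j = -majorana m := by
  by_cases h : j = m
  · subst h; left; rw [majorana_mul_self, one_mul]
  · right; rw [majorana_anticomm h, neg_mul, mul_assoc, majorana_mul_self, mul_one]

lemma majorana_conj_majoranaObs {n : ℕ} (j : Fin (2 * n)) (S : Finset (Fin (2 * n))) :
    majorana j * majoranaObs S * majorana j = majoranaObs S ∨
      majorana j * majoranaObs S * majorana j = -majoranaObs S := by
  have e : S.map (Equiv.toEmbedding 1) = S := Finset.map_refl
  simpa only [e] using conj_majoranaObs (majorana_mul_self j) 1 (conj_majorana j) S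

/-- The Hermitian unitary `(γ_i - γ_j) / √2`. Conjugation by it exchanges the Majorana operators
`i` and `j`, up to signs. -/
def swapUnitary {n : ℕ} (i j : Fin (2 * n)) : FockOp n :=
  ((1 / √2 : ℝ) : ℂ) • (majorana i - majorana j)

lemma swapUnitary_conjTranspose {n : ℕ} (i j : Fin (2 * n)) :
    (swapUnitary i j)ᴴ = swapUnitary i j := by
  rw [swapUnitary, Matrix.conjTranspose_smul, Matrix.conjTranspose_sub, majorana_conjTranspose,
    majorana_conjTranspose, RCLike.star_def, Complex.conj_ofReal]

lemma swapUnitary_mul_self {n : ℕ} {i j : Fin (2 * n)} (h : i ≠ j) :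
    swapUnitary i j * swapUnitary i j = 1 := by
  have e : ((1 / √2 : ℝ) : ℂ) * ((1 / √2 : ℝ) : ℂ) = 1 / 2 := by
    rw [← Complex.ofReal_mul, div_mul_div_comm, Real.mul_self_sqrt (by norm_num)]
    norm_num
  rw [swapUnitary, smul_mul_smul_comm, e, sub_mul, mul_sub, mul_sub, majorana_mul_self,
    majorana_mul_self, majorana_anticomm h]
  module

/-- Taking the difference of the two Majoranas, not their sum, makes the sign the same for every
`m`. -/
lemma swapUnitary_mul_majorana {n : ℕ} {i j : Fin (2 * n)} (h : i ≠ j) (m : Fin (2 * n)) :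
    swapUnitary i j * majorana m = -(majorana (Equiv.swap i j m) * swapUnitary i j) := by
  rw [swapUnitary, smul_mul_assoc, mul_smul_comm, ← smul_neg]
  congr 1
  rw [sub_mul, mul_sub]
  by_cases hi : m = i
  · subst hi
    rw [Equiv.swap_apply_left, majorana_mul_self, majorana_mul_self]
    abel
  by_cases hj : m = j
  · subst hj
    rw [Equiv.swap_apply_right, majorana_mul_self, majorana_mul_self]
    abel
  rw [Equiv.swap_apply_of_ne_of_ne hi hj, majorana_anticomm hi, majorana_anticomm hj]
  abel

lemma swapUnitary_conj_majoranaObs {n : ℕ} {i j : Fin (2 * n)} (h : i ≠ j)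
    (S : Finset (Fin (2 * n))) :
    swapUnitary i j * majoranaObs S * swapUnitary i j =
        majoranaObs (S.map (Equiv.swap i j).toEmbedding) ∨
      swapUnitary i j * majoranaObs S * swapUnitary i j =
        -majoranaObs (S.map (Equiv.swap i j).toEmbedding) := by
  refine conj_majoranaObs (swapUnitary_mul_self h) _ (fun m => Or.inr ?_) S
  rw [swapUnitary_mul_majorana h, neg_mul, mul_assoc, swapUnitary_mul_self h, mul_one]

/-! ### Classical simulation of operator families -/

/-- Positive operators `G l` with sum `X` and weights `f S l ∈ [-1, 1]` produce the operators
`Y S = ∑ l, f S l • G l`. -/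
def Simulates {n : ℕ} {ι : Type} (X : FockOp n) (Y : ι → FockOp n) : Prop :=
  ∃ (Λ : Type) (_ : Fintype Λ) (G : Λ → FockOp n) (f : ι → Λ → ℝ),
    (∀ l, (G l).PosSemidef) ∧ (∀ S l, |f S l| ≤ 1) ∧ ∑ l, G l = X ∧
    ∀ S, ∑ l, (f S l : ℂ) • G l = Y S

namespace Simulates

variable {n : ℕ} {ι : Type} {X X' : FockOp n} {Y Y' : ι → FockOp n}

lemma zero : Simulates (0 : FockOp n) (fun _ : ι => 0) :=
  ⟨Empty, inferInstance, fun _ => 0, fun _ _ => 0, by simp, by simp, by simp, by simp⟩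

lemma add (h : Simulates X Y) (h' : Simulates X' Y') :
    Simulates (X + X') (fun S => Y S + Y' S) := by
  obtain ⟨Λ, _, G, f, hG, hf, hX, hY⟩ := h
  obtain ⟨Λ', _, G', f', hG', hf', hX', hY'⟩ := h'
  refine ⟨Λ ⊕ Λ', inferInstance, Sum.elim G G', fun S => Sum.elim (f S) (f' S), ?_, ?_, ?_, ?_⟩
  · rintro (l | l)
    exacts [hG l, hG' l]
  · rintro S (l | l)
    exacts [hf S l, hf' S l]
  · simp [hX, hX']
  · intro S
    simp [← hY, ← hY']

lemma sum {α : Type} (s : Finset α) {X : α → FockOp n} {Y : α → ι → FockOp n}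
    (h : ∀ a, Simulates (X a) (Y a)) :
    Simulates (∑ a ∈ s, X a) (fun S => ∑ a ∈ s, Y a S) := by
  classical
  induction s using Finset.induction_on with
  | empty => simpa using zero
  | insert a s ha ih =>
    simp only [Finset.sum_insert ha]
    exact (h a).add ih

lemma smul (h : Simulates X Y) {c : ℝ} (hc : 0 ≤ c) :
    Simulates ((c : ℂ) • X) (fun S => (c : ℂ) • Y S) := by
  obtain ⟨Λ, _, G, f, hG, hf, hX, hY⟩ := h
  refine ⟨Λ, inferInstance, fun l => (c : ℂ) • G l, f,
    fun l => (hG l).smul (by exact_mod_cast hc), hf, ?_, fun S => ?_⟩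
  · rw [← Finset.smul_sum, hX]
  · simp only [← hY, Finset.smul_sum]
    exact Finset.sum_congr rfl fun l _ => smul_comm _ _ _

lemma conj (h : Simulates X Y) {U : FockOp n} (hU : Uᴴ = U) :
    Simulates (U * X * U) (fun S => U * Y S * U) := by
  obtain ⟨Λ, _, G, f, hG, hf, hX, hY⟩ := h
  refine ⟨Λ, inferInstance, fun l => U * G l * U, f, fun l => ?_, hf, ?_, fun S => ?_⟩
  · have := (hG l).mul_mul_conjTranspose_same U
    rwa [hU] at this
  · rw [← Finset.sum_mul, ← Finset.mul_sum, hX]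
  · simp only [← hY, Finset.mul_sum, Finset.sum_mul]
    exact Finset.sum_congr rfl fun l _ => by rw [mul_smul_comm, smul_mul_assoc]

lemma comp (h : Simulates X Y) {κ : Type} (r : κ → ι) : Simulates X (fun S => Y (r S)) := by
  obtain ⟨Λ, _, G, f, hG, hf, hX, hY⟩ := h
  exact ⟨Λ, inferInstance, G, fun S => f (r S), hG, fun S => hf _, hX, fun S => hY _⟩

/-- A sign on one target is absorbed by negating its weights, which amounts to exchanging the two
outcomes. -/
lemma of_eq_or_neg (h : Simulates X Y) (hY' : ∀ S, Y' S = Y S ∨ Y' S = -Y S) :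
    Simulates X Y' := by
  classical
  obtain ⟨Λ, _, G, f, hG, hf, hX, hY⟩ := h
  refine ⟨Λ, inferInstance, G, fun S l => if Y' S = Y S then f S l else -f S l, hG, ?_, hX, ?_⟩
  · intro S l
    beta_reduce
    split_ifs
    exacts [hf S l, (abs_neg _).trans_le (hf S l)]
  · intro S
    beta_reduce
    split_ifs with hS
    · rw [hY, hS]
    · rw [(hY' S).resolve_left hS, ← hY, ← Finset.sum_neg_distrib]
      simp

end Simulates

/-! ### Twirling over the Majorana operators -/

/-- The average of `A` and its conjugate by the Majorana operator `j`. -/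
def twirl {n : ℕ} (j : Fin (2 * n)) (A : FockOp n) : FockOp n :=
  ((1 / 2 : ℝ) : ℂ) • (A + majorana j * A * majorana j)

lemma trace_twirl {n : ℕ} (j : Fin (2 * n)) (A : FockOp n) : (twirl j A).trace = A.trace := by
  rw [twirl, Matrix.trace_smul, Matrix.trace_add, Matrix.trace_mul_comm, ← mul_assoc,
    majorana_mul_self, one_mul, smul_eq_mul]
  push_cast
  ring

lemma commute_twirl_self {n : ℕ} (j : Fin (2 * n)) (A : FockOp n) :
    Commute (twirl j A) (majorana j) := by
  refine Commute.smul_left ?_ _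
  change _ * _ = _ * _
  rw [add_mul, mul_add, mul_assoc _ _ (majorana j), majorana_mul_self, ← mul_assoc (majorana j),
    ← mul_assoc (majorana j) (majorana j), majorana_mul_self, one_mul, mul_one, add_comm]

/-- Moving `γ_i` past both copies of `γ_j` gives two cancelling signs. Hence later twirls keep what
earlier ones achieved. -/
lemma commute_twirl {n : ℕ} {A : FockOp n} {i : Fin (2 * n)} (h : Commute A (majorana i))
    (j : Fin (2 * n)) : Commute (twirl j A) (majorana i) := by
  by_cases hij : j = i
  · subst hij; exact commute_twirl_self j A
  refine Commute.smul_left (h.add_left ?_) _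
  change _ * _ = _ * _
  rw [mul_assoc, majorana_anticomm hij, mul_neg, ← mul_assoc, mul_assoc _ A, h.eq,
    ← mul_assoc (majorana j), majorana_anticomm hij]
  simp only [neg_mul, neg_neg, mul_assoc]

/-- The twirl over all Majorana operators, one after the other. -/
def fullTwirl {n : ℕ} (A : FockOp n) : FockOp n := (List.finRange (2 * n)).foldr twirl A

lemma trace_foldr_twirl {n : ℕ} (l : List (Fin (2 * n))) (A : FockOp n) :
    (l.foldr twirl A).trace = A.trace := by
  induction l with
  | nil => rfl
  | cons j l ih => rw [List.foldr_cons, trace_twirl, ih]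

lemma commute_foldr_twirl {n : ℕ} {l : List (Fin (2 * n))} {m : Fin (2 * n)} (hm : m ∈ l)
    (A : FockOp n) : Commute (l.foldr twirl A) (majorana m) := by
  induction l with
  | nil => simp at hm
  | cons j l ih =>
    rcases List.mem_cons.mp hm with rfl | hm
    · exact commute_twirl_self _ _
    · exact commute_twirl (ih hm) j

/-- The full twirl commutes with every Majorana, so it is scalar by irreducibility; trace
preservation fixes the scalar. -/
lemma fullTwirl_eq {n : ℕ} (A : FockOp n) : fullTwirl A = (A.trace / 2 ^ n) • 1 := by
  obtain ⟨c, hc⟩ := eq_smul_one_of_commute_majorana (B := fullTwirl A)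
    fun m => commute_foldr_twirl (List.mem_finRange m) A
  have ht : (fullTwirl A).trace = A.trace := trace_foldr_twirl _ _
  rw [hc, Matrix.trace_smul, Matrix.trace_one, Fintype.card_finset, Fintype.card_fin,
    smul_eq_mul] at ht
  rw [hc, ← ht]
  push_cast
  rw [mul_div_cancel_right₀ _ (by positivity)]

/-- Conjugation by `γ_j` changes `γ_S` only by a sign. With the targets factored as `γ_S Z_S`, that
sign goes into the weights and only `Z_S` is averaged. -/
lemma Simulates.twirl {n k : ℕ} {X : FockOp n} {Z : IndexSet n k → FockOp n}
    (h : Simulates X (fun S => majoranaObs S.1 * Z S)) (j : Fin (2 * n)) :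
    Simulates (twirl j X) (fun S => majoranaObs S.1 * MajoranaJM.twirl j (Z S)) := by
  have h1 : Simulates (majorana j * X * majorana j)
      (fun S => majoranaObs S.1 * (majorana j * Z S * majorana j)) := by
    refine (h.conj (majorana_conjTranspose j)).of_eq_or_neg fun S => ?_
    have e : majoranaObs S.1 * (majorana j * Z S * majorana j) =
        majorana j * (majorana j * majoranaObs S.1 * majorana j) * Z S * majorana j := by
      simp only [← mul_assoc]
      rw [majorana_mul_self, one_mul]
    rw [e]
    rcases majorana_conj_majoranaObs j S.1 with hs | hs <;> rw [hs] <;> simp [mul_assoc]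
  convert (h.add h1).smul (c := 1 / 2) (by norm_num) using 2 with S
  · rfl
  · rw [MajoranaJM.twirl, mul_smul_comm, mul_add]

lemma Simulates.fullTwirl {n k : ℕ} {X : FockOp n} {Z : IndexSet n k → FockOp n}
    (h : Simulates X (fun S => majoranaObs S.1 * Z S)) :
    Simulates (fullTwirl X) (fun S => majoranaObs S.1 * MajoranaJM.fullTwirl (Z S)) := by
  unfold MajoranaJM.fullTwirl
  induction List.finRange (2 * n) with
  | nil => exact h
  | cons j l ih => exact ih.twirl j

/-- Twirling turns a simulation of arbitrary operators into one of Majorana observables. -/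
lemma Simulates.of_trace_eq_one {n k : ℕ} {X : FockOp n} {Y : IndexSet n k → FockOp n}
    (h : Simulates X Y) (hX : X.trace = 1) :
    Simulates 1 (fun S => (majoranaObs S.1 * Y S).trace • majoranaObs S.1) := by
  have h1 : Simulates X (fun S => majoranaObs S.1 * (majoranaObs S.1 * Y S)) := by
    simpa only [← mul_assoc, majoranaObs_mul_self, one_mul] using h
  -- The factor `2 ^ n` is the Fock space dimension and cancels the normalisation of the twirl.
  have h2 := h1.fullTwirl.smul (c := 2 ^ n) (by positivity)
  have e : ((2 ^ n : ℝ) : ℂ) ≠ 0 := by exact_mod_cast pow_ne_zero n two_ne_zero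
  convert h2 using 2 with S
  · rw [fullTwirl_eq, hX, smul_smul]
    push_cast at e ⊢
    rw [mul_one_div_cancel e, one_smul]
  · rw [fullTwirl_eq, mul_smul_comm, mul_one, smul_smul]
    push_cast at e ⊢
    rw [mul_div_cancel₀ _ e]

/-! ### Permuting the Majorana operators -/

/-- The action of a permutation of the Majorana labels on the `k`-element subsets. -/
def permIndex {n k : ℕ} (σ : Equiv.Perm (Fin (2 * n))) (S : IndexSet n k) : IndexSet n k :=
  ⟨S.1.map σ.toEmbedding, by rw [Finset.card_map, S.2]⟩

lemma permIndex_one {n k : ℕ} (S : IndexSet n k) : permIndex 1 S = S :=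
  Subtype.ext Finset.map_refl

lemma permIndex_mul {n k : ℕ} (σ τ : Equiv.Perm (Fin (2 * n))) (S : IndexSet n k) :
    permIndex (σ * τ) S = permIndex σ (permIndex τ S) :=
  Subtype.ext (by simp only [permIndex, Finset.map_map]; rfl)

lemma exists_permIndex_eq {n k : ℕ} (S S' : IndexSet n k) :
    ∃ σ : Equiv.Perm (Fin (2 * n)), permIndex σ S = S' := by
  have e : {x // x ∈ S.1} ≃ {x // x ∈ S'.1} := Finset.equivOfCardEq (S.2.trans S'.2.symm)
  refine ⟨e.extendSubtype, Subtype.ext (Finset.eq_of_subset_of_card_le ?_ ?_)⟩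
  · intro x hx
    obtain ⟨y, hy, rfl⟩ := Finset.mem_map.mp hx
    exact e.extendSubtype_mem y hy
  · rw [S'.2, (permIndex _ S).2]

lemma permIndex_bijective {n k : ℕ} (σ : Equiv.Perm (Fin (2 * n))) :
    Function.Bijective (permIndex σ : IndexSet n k → IndexSet n k) := by
  refine Function.bijective_iff_has_inverse.mpr ⟨permIndex σ⁻¹, fun S => ?_, fun S => ?_⟩ <;>
    simp [← permIndex_mul, permIndex_one]

/-- The unitary carries `γ` of the swapped subset to `±γ_S`, so conjugating and relabelling moves
the coefficients while the observables stay put. -/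
lemma Simulates.swap {n k : ℕ} {c : IndexSet n k → ℂ}
    (h : Simulates 1 (fun S => c S • majoranaObs S.1)) {i j : Fin (2 * n)} (hij : i ≠ j) :
    Simulates 1 (fun S => c (permIndex (Equiv.swap i j) S) • majoranaObs S.1) := by
  have h1 := (h.conj (swapUnitary_conjTranspose i j)).comp (permIndex (Equiv.swap i j))
  rw [mul_one, swapUnitary_mul_self hij] at h1
  refine h1.of_eq_or_neg fun S => ?_
  have e : ((permIndex (Equiv.swap i j) S).1.map (Equiv.swap i j).toEmbedding) = S.1 := by
    change (permIndex (Equiv.swap i j) (permIndex (Equiv.swap i j) S)).1 = _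
    rw [← permIndex_mul, Equiv.swap_mul_self, permIndex_one]
  have hs := swapUnitary_conj_majoranaObs hij (permIndex (Equiv.swap i j) S).1
  rw [e] at hs
  simp only [mul_smul_comm, smul_mul_assoc]
  rcases hs with hs | hs <;> rw [hs] <;> simp

lemma Simulates.perm {n k : ℕ} {c : IndexSet n k → ℂ}
    (h : Simulates 1 (fun S => c S • majoranaObs S.1)) (σ : Equiv.Perm (Fin (2 * n))) :
    Simulates 1 (fun S => c (permIndex σ S) • majoranaObs S.1) := by
  -- The coefficients must vary, since each transposition is absorbed into them before the induction
  -- hypothesis is used.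
  induction σ using Equiv.Perm.swap_induction_on generalizing c with
  | one => simpa only [permIndex_one] using h
  | swap_mul f x y hxy ih =>
    simp only [permIndex_mul]
    exact ih (c := fun S => c (permIndex (Equiv.swap x y) S)) (h.swap hxy)

/-- Permutations act transitively on k-subsets, so the sum over `σ` does not depend on `S₀`; double
counting gives the rest. -/
lemma card_mul_sum_permIndex {n k : ℕ} (c : IndexSet n k → ℂ) (S₀ : IndexSet n k) :
    (Fintype.card (IndexSet n k) : ℂ) * ∑ σ : Equiv.Perm (Fin (2 * n)), c (permIndex σ S₀) =
      (Fintype.card (Equiv.Perm (Fin (2 * n))) : ℂ) * ∑ S, c S := by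
  have h1 : ∀ S, ∑ σ : Equiv.Perm (Fin (2 * n)), c (permIndex σ S) =
      ∑ σ : Equiv.Perm (Fin (2 * n)), c (permIndex σ S₀) := by
    intro S
    obtain ⟨τ, rfl⟩ := exists_permIndex_eq S₀ S
    simp only [← permIndex_mul]
    exact Equiv.sum_comp (Equiv.mulRight τ) fun σ => c (permIndex σ S₀)
  have h2 : ∑ S, ∑ σ : Equiv.Perm (Fin (2 * n)), c (permIndex σ S) =
      ∑ σ : Equiv.Perm (Fin (2 * n)), ∑ S, c S := by
    rw [Finset.sum_comm]
    exact Finset.sum_congr rfl fun σ _ => (permIndex_bijective σ).sum_comp c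
  simpa only [h1, Finset.sum_const, Finset.card_univ, nsmul_eq_mul] using h2

/-- Averaging over all permutations of the Majorana labels makes the coefficients uniform. -/
lemma Simulates.average {n k : ℕ} {c : IndexSet n k → ℂ}
    (h : Simulates 1 (fun S => c S • majoranaObs S.1)) :
    Simulates 1 (fun S : IndexSet n k =>
      ((∑ S, c S) / Fintype.card (IndexSet n k)) • majoranaObs S.1) := by
  have h1 := (Simulates.sum Finset.univ h.perm).smul
    (c := (Fintype.card (Equiv.Perm (Fin (2 * n))) : ℝ)⁻¹) (by positivity)
  have hN : (Fintype.card (Equiv.Perm (Fin (2 * n))) : ℂ) ≠ 0 :=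
    Nat.cast_ne_zero.mpr Fintype.card_ne_zero
  convert h1 using 2 with S
  · rw [Finset.sum_const, Finset.card_univ, ← Nat.cast_smul_eq_nsmul ℂ, smul_smul]
    push_cast
    rw [inv_mul_cancel₀ hN, one_smul]
  · have hC : (Fintype.card (IndexSet n k) : ℂ) ≠ 0 :=
      Nat.cast_ne_zero.mpr (Fintype.card_pos_iff.mpr ⟨S⟩).ne'
    rw [← Finset.sum_smul, smul_smul]
    congr 1
    have := card_mul_sum_permIndex c S
    push_cast
    field_simp
    linear_combination -this

/-! ### Joint measurability as simulation -/

lemma jointlyMeasurable_iff_simulates {n k : ℕ} (η : ℝ) :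
    JointlyMeasurable (fun (S : IndexSet n k) (e : ℤˣ) => unsharp η S.1 e) ↔
      Simulates 1 (fun S : IndexSet n k => (η : ℂ) • majoranaObs S.1) := by
  have hu : (Finset.univ : Finset ℤˣ) = {1, -1} := by decide
  have hne : (1 : ℤˣ) ≠ -1 := by decide
  constructor
  · rintro ⟨-, Λ, _, G, D, hG, hD, hD1, hM⟩
    refine ⟨Λ, inferInstance, G, fun S l => D S l 1 - D S l (-1), hG.1, fun S l => ?_, hG.2,
      fun S => ?_⟩
    · have h1 := hD S l 1
      have h2 := hD S l (-1)
      rw [abs_le]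
      constructor <;> linarith
    · have h1 := hM S 1
      have h2 := hM S (-1)
      simp only [Complex.ofReal_sub, sub_smul, Finset.sum_sub_distrib]
      rw [← h1, ← h2]
      simp only [unsharp, Units.val_one, Units.val_neg, Int.cast_one, Int.cast_neg]
      module
  · rintro ⟨Λ, _, G, f, hG, hf, hG1, hM⟩
    -- The response `(1 + e f) / 2` is the one with mean outcome `f`.
    have key : ∀ (S : IndexSet n k) (e : ℤˣ),
        unsharp η S.1 e = ∑ l, (((1 + (e : ℤ) * f S l) / 2 : ℝ) : ℂ) • G l := by
      intro S e
      have h1 : ∀ l, (((1 + (e : ℤ) * f S l) / 2 : ℝ) : ℂ) • G l =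
          (1 / 2 : ℂ) • (G l + ((e : ℤ) : ℂ) • ((f S l : ℂ) • G l)) := by
        intro l
        push_cast
        module
      rw [Finset.sum_congr rfl fun l _ => h1 l, ← Finset.smul_sum, Finset.sum_add_distrib, hG1,
        ← Finset.smul_sum, hM, smul_smul, unsharp]
    have hD : ∀ (S : IndexSet n k) (l : Λ) (e : ℤˣ),
        0 ≤ (1 + (e : ℤ) * f S l) / 2 ∧ (1 + (e : ℤ) * f S l) / 2 ≤ 1 := by
      intro S l e
      have h := abs_le.mp (hf S l)
      rcases Int.units_eq_one_or e with rfl | rfl <;> constructor <;> push_cast <;> linarith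
    refine ⟨fun S => ⟨fun e => ?_, ?_⟩, Λ, inferInstance, G,
      fun S l e => (1 + (e : ℤ) * f S l) / 2, ⟨hG, hG1⟩, hD, fun S l => ?_, key⟩
    · beta_reduce
      rw [key]
      exact Matrix.posSemidef_sum _ fun l _ => (hG l).smul (by exact_mod_cast (hD S l e).1)
    · rw [hu, Finset.sum_pair hne]
      simp only [unsharp, Units.val_one, Units.val_neg, Int.cast_one, Int.cast_neg]
      module
    · rw [hu, Finset.sum_pair hne]
      push_cast
      ring

/-! ### The upper bound -/

lemma signedSum_conjTranspose {n k : ℕ} (e : IndexSet n k → ℤˣ) :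
    (signedSum e)ᴴ = signedSum e := by
  rw [signedSum, Matrix.conjTranspose_sum]
  refine Finset.sum_congr rfl fun S _ => ?_
  rw [Matrix.conjTranspose_smul, majoranaObs_conjTranspose]
  simp

open scoped MatrixOrder in
lemma posSemidef_norm_sub {d : Type} [Fintype d] [DecidableEq d] {H : Matrix d d ℂ}
    (hH : Hᴴ = H) : ((‖H‖ : ℂ) • (1 : Matrix d d ℂ) - H).PosSemidef := by
  have h := IsSelfAdjoint.le_algebraMap_norm_self (a := H) hH
  rw [Matrix.le_iff, Algebra.algebraMap_eq_smul_one] at h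
  simpa only [Complex.coe_smul] using h

open scoped MatrixOrder in
lemma re_trace_mul_le {d : Type} [Fintype d] [DecidableEq d] {H G : Matrix d d ℂ}
    (hH : Hᴴ = H) (hG : G.PosSemidef) : (H * G).trace.re ≤ ‖H‖ * G.trace.re := by
  -- With `G = B† B`, cyclicity turns `tr((‖H‖ - H) G)` into the trace of the positive operator `B
  -- (‖H‖ - H) B†`.
  obtain ⟨B, rfl⟩ := CStarAlgebra.nonneg_iff_eq_star_mul_self.mp (Matrix.nonneg_iff_posSemidef.mpr hG)
  rw [Matrix.star_eq_conjTranspose]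
  have h := ((posSemidef_norm_sub hH).mul_mul_conjTranspose_same B).trace_nonneg
  rw [mul_assoc, Matrix.trace_mul_comm, mul_assoc, sub_mul, Matrix.trace_sub, smul_mul_assoc,
    one_mul, Matrix.trace_smul] at h
  have := (Complex.le_def.mp h).1
  simp only [Complex.zero_re, Complex.sub_re, smul_eq_mul, Complex.re_ofReal_mul] at this
  linarith

/-- Choosing each `e S` as the sign of its trace turns the sum of absolute values into one trace
against `signedSum e`. -/
lemma sum_abs_re_trace_le {n k : ℕ} {G : FockOp n} (hG : G.PosSemidef) :
    ∑ S : IndexSet n k, |(majoranaObs S.1 * G).trace.re| ≤ maxNorm n k * G.trace.re := by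
  classical
  set e : IndexSet n k → ℤˣ := fun S => if 0 ≤ (majoranaObs S.1 * G).trace.re then 1 else -1
    with he
  have h1 : ∑ S : IndexSet n k, |(majoranaObs S.1 * G).trace.re| =
      (signedSum e * G).trace.re := by
    rw [signedSum, Finset.sum_mul, Matrix.trace_sum, Complex.re_sum]
    refine Finset.sum_congr rfl fun S _ => ?_
    rw [smul_mul_assoc, Matrix.trace_smul, he]
    beta_reduce
    split_ifs with h
    · simp [abs_of_nonneg h]
    · simp [abs_of_neg (not_le.mp h)]
  have h2 : ‖signedSum e‖ ≤ maxNorm n k :=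
    Finset.le_sup' (fun e : IndexSet n k → ℤˣ => ‖signedSum e‖) (Finset.mem_univ e)
  rw [h1]
  exact (re_trace_mul_le (signedSum_conjTranspose e) hG).trans
    (mul_le_mul_of_nonneg_right h2 (Complex.le_def.mp hG.trace_nonneg).1)

lemma trace_one_re (n : ℕ) : (1 : FockOp n).trace.re = 2 ^ n := by
  rw [Matrix.trace_one, Fintype.card_finset, Fintype.card_fin, Complex.natCast_re]
  push_cast
  rfl

lemma Simulates.card_mul_le_maxNorm {n k : ℕ} {η : ℝ}
    (h : Simulates 1 (fun S : IndexSet n k => (η : ℂ) • majoranaObs S.1)) :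
    Fintype.card (IndexSet n k) * η ≤ maxNorm n k := by
  obtain ⟨Λ, _, G, f, hG, hf, hG1, hM⟩ := h
  have h1 : ∀ S : IndexSet n k,
      η * 2 ^ n = ∑ l, f S l * (majoranaObs S.1 * G l).trace.re := by
    intro S
    have := congrArg (fun A => (majoranaObs S.1 * A).trace.re) (hM S)
    simp only [Finset.mul_sum, mul_smul_comm, Matrix.trace_sum, Matrix.trace_smul, Complex.re_sum,
      smul_eq_mul, Complex.re_ofReal_mul, majoranaObs_mul_self, trace_one_re] at this
    exact this.symm
  have h2 : Fintype.card (IndexSet n k) * (η * 2 ^ n) ≤ maxNorm n k * 2 ^ n := by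
    calc Fintype.card (IndexSet n k) * (η * 2 ^ n)
        = ∑ S : IndexSet n k, ∑ l, f S l * (majoranaObs S.1 * G l).trace.re := by
          simp only [← h1, Finset.sum_const, Finset.card_univ, nsmul_eq_mul]
      _ ≤ ∑ S : IndexSet n k, ∑ l, |(majoranaObs S.1 * G l).trace.re| := by
          refine Finset.sum_le_sum fun S _ => Finset.sum_le_sum fun l _ => ?_
          refine (le_abs_self _).trans ?_
          rw [abs_mul]
          exact mul_le_of_le_one_left (abs_nonneg _) (hf S l)
      _ ≤ ∑ l, maxNorm n k * (G l).trace.re := by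
          rw [Finset.sum_comm]
          exact Finset.sum_le_sum fun l _ => sum_abs_re_trace_le (hG l)
      _ = maxNorm n k * 2 ^ n := by
          rw [← Finset.mul_sum, ← Complex.re_sum, ← Matrix.trace_sum, hG1, trace_one_re]
  rw [← mul_assoc] at h2
  exact le_of_mul_le_mul_right h2 (by positivity)

/-! ### The optimal measurement -/

/-- A Hermitian matrix has ‖H‖ or -‖H‖ as an eigenvalue; `P` is the projection onto a unit
eigenvector. -/
lemma exists_posSemidef_trace_mul_eq {d : Type} [Fintype d] [DecidableEq d] [Nonempty d]
    {H : Matrix d d ℂ} (hH : H.IsHermitian) :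
    ∃ P : Matrix d d ℂ, P.PosSemidef ∧ P.trace = 1 ∧
      ((H * P).trace = ‖H‖ ∨ (H * P).trace = -‖H‖) := by
  have key : ∀ μ ∈ spectrum ℝ H, ∃ P : Matrix d d ℂ, P.PosSemidef ∧ P.trace = 1 ∧
      (H * P).trace = μ := by
    intro μ hμ
    rw [hH.spectrum_real_eq_range_eigenvalues] at hμ
    obtain ⟨i, rfl⟩ := hμ
    set v : d → ℂ := ⇑(hH.eigenvectorBasis i) with hv
    have hv1 : v ⬝ᵥ star v = 1 := by
      have h := inner_self_eq_norm_sq_to_K (𝕜 := ℂ) (hH.eigenvectorBasis i)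
      rw [hH.eigenvectorBasis.orthonormal.1 i, EuclideanSpace.inner_eq_star_dotProduct] at h
      simpa using h
    refine ⟨Matrix.vecMulVec v (star v), Matrix.posSemidef_vecMulVec_self_star v, ?_, ?_⟩
    · rw [Matrix.trace_vecMulVec, hv1]
    · rw [Matrix.mul_vecMulVec, hv, hH.mulVec_eigenvectorBasis, ← hv, Matrix.trace_vecMulVec,
        smul_dotProduct, hv1]
      simp
  rcases CStarAlgebra.norm_or_neg_norm_mem_spectrum (a := H) hH with h | h
  · obtain ⟨P, h1, h2, h3⟩ := key _ h
    exact ⟨P, h1, h2, Or.inl h3⟩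
  · obtain ⟨P, h1, h2, h3⟩ := key _ h
    exact ⟨P, h1, h2, Or.inr (by simpa using h3)⟩

lemma simulates_maxNorm_div (n k : ℕ) :
    Simulates 1 (fun S : IndexSet n k =>
      ((maxNorm n k / Fintype.card (IndexSet n k) : ℝ) : ℂ) • majoranaObs S.1) := by
  obtain ⟨e, -, he⟩ := Finset.exists_mem_eq_sup' (Finset.univ_nonempty)
    fun e : IndexSet n k → ℤˣ => ‖signedSum e‖
  obtain ⟨P, hP, hP1, hHP⟩ := exists_posSemidef_trace_mul_eq (signedSum_conjTranspose e)
  have h0 : Simulates P (fun S : IndexSet n k => ((e S : ℤ) : ℂ) • P) :=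
    ⟨Unit, inferInstance, fun _ => P, fun S _ => (e S : ℤ), fun _ => hP, fun S _ => by
      rcases Int.units_eq_one_or (e S) with h | h <;> simp [h], by simp, by simp⟩
  have h1 := (h0.of_trace_eq_one hP1).average
  have hs : ∑ S : IndexSet n k, (majoranaObs S.1 * ((e S : ℤ) : ℂ) • P).trace =
      (signedSum e * P).trace := by
    rw [signedSum, Finset.sum_mul, Matrix.trace_sum]
    simp only [mul_smul_comm, smul_mul_assoc]
  have hm : (‖signedSum e‖ : ℂ) = maxNorm n k := congrArg Complex.ofReal he.symm
  rw [hs] at h1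
  -- If the extremal eigenvalue is -‖H‖, all weights are negated.
  refine h1.of_eq_or_neg fun S => ?_
  rcases hHP with h | h <;> rw [h, hm] <;> push_cast
  · exact Or.inl rfl
  · right
    rw [neg_div, neg_smul, neg_neg]

end MajoranaJM

end

theorem lemma1 (n k : ℕ) (hk : k ≤ 2 * n) :
    MajoranaJM.incompatibilityRobustness n k =
        1 / (Fintype.card (MajoranaJM.IndexSet n k) : ℝ) * MajoranaJM.maxNorm n k ∧
      IsGreatest (MajoranaJM.compatibleSharpness n k)
        (1 / (Fintype.card (MajoranaJM.IndexSet n k) : ℝ) * MajoranaJM.maxNorm n k) := by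
  -- For `k > 2n` there would be no subsets, and every η would be vacuously compatible.
  have hcard : (0 : ℝ) < Fintype.card (MajoranaJM.IndexSet n k) := by
    obtain ⟨S, -, hS⟩ := Finset.exists_subset_card_eq
      (s := (Finset.univ : Finset (Fin (2 * n)))) (n := k) (by simpa using hk)
    exact Nat.cast_pos.mpr (Fintype.card_pos_iff.mpr ⟨⟨S, hS⟩⟩)
  have h : IsGreatest (MajoranaJM.compatibleSharpness n k)
      (1 / (Fintype.card (MajoranaJM.IndexSet n k) : ℝ) * MajoranaJM.maxNorm n k) := by
    rw [one_div_mul_eq_div]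
    refine ⟨(MajoranaJM.jointlyMeasurable_iff_simulates _).mpr
      (MajoranaJM.simulates_maxNorm_div n k), fun η hη => ?_⟩
    rw [le_div_iff₀' hcard]
    exact ((MajoranaJM.jointlyMeasurable_iff_simulates η).mp hη).card_mul_le_maxNorm
  exact ⟨h.csSup_eq, h⟩
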